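/- Let $\theta\in[0,2\pi)$ and put $$\beta_1=\tfrac1{\sqrt2}\cos\theta-\tfrac1{\sqrt6}\sin\theta,\quad \beta_2=-\tfrac1{\sqrt2}\cos\theta-\tfrac1{\sqrt6}\sin\theta,\quad \beta_3=\tfrac2{\sqrt6}\sin\theta,$$ $$\gamma_1=-\tfrac1{\sqrt6}\cos\theta-\tfrac1{\sqrt2}\sin\theta,\quad \gamma_2=-\tfrac1{\sqrt6}\cos\theta+\tfrac1{\sqrt2}\sin\theta,\quad \gamma_3=\tfrac2{\sqrt6}\cos\theta.$$ Let $y_1,y_2,y_3:\mathbb R\to\mathbb C$, $v:\mathbb R\to\mathbb R$ be functions of $s$ and $z_1,z_2,z_3:\mathbb R\to\mathbb C$, $w:\mathbb R\to\mathbb R$ functions of $t$ such that, for all $s,t$ and for $j=1,2,3$ (indices modulo 3), $$\frac{dy_j}{ds}=\beta_j\,\overline{y_{j+1}y_{j+2}},\qquad \frac{dz_j}{dt}=\gamma_j\,\overline{z_{j+1}z_{j+2}},\qquad |y_j|^2=\beta_jv+1,\qquad |z_j|^2=\gamma_jw+1.$$ Define $\Phi:\mathbb R^3\to\mathbb C^3$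 by $\Phi(r,s,t)=\frac1{\sqrt3}\bigl(r\,y_1(s)z_1(t),\,r\,y_2(s)z_2(t),\,r\,y_3(s)z_3(t)\bigr)$. Then $\Phi$ is smooth, and for all $r,s,t$ we have $|\Phi(r,s,t)|^2=r^2$, the vectors $\frac{\partial\Phi}{\partial r},\frac{\partial\Phi}{\partial s},\frac{\partial\Phi}{\partial t}$ are mutually orthogonal in $\mathbb C^3=\mathbb R^6$, $\bigl|\frac{\partial\Phi}{\partial r}\bigr|^2=1$, and $$\Bigl|\frac{\partial\Phi}{\partial s}\Bigr|^2=\Bigl|\frac{\partial\Phi}{\partial t}\Bigr|^2=2r^2\bigl(a+bv(s)+cw(t)\bigr),$$ where $$a=\tfrac16\sum_j\beta_j^2=\tfrac16\sum_j\gamma_j^2=\tfrac16,$$ $$b=-\tfrac16\sum_j\beta_j^3=\tfrac16\sum_j\beta_j\gamma_j^2=-\tfrac12\beta_1\beta_2\beta_3,\qquad c=\tfrac16\sum_j\beta_j^2\gamma_j=-\tfrac16\sum_j\gamma_j^3=-\tfrac12\gamma_1\gamma_2\gamma_3.$$ Moreover the maps $\phi:\mathbb R^2\to\mathcal S^5$,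 $\phi(s,t)=\Phi(1,s,t)$, and $\psi:\mathbb R^2\to\mathbb{CP}^2$, $\psi(s,t)=[\Phi(1,s,t)]$, are conformal harmonic maps. Here $\mathcal S^5\subset\mathbb C^3$ has its round metric, $\mathbb{CP}^2$ has the Fubini–Study metric for which the Hopf projection $\mathcal S^5\to\mathbb{CP}^2$ is a Riemannian submersion, and $\mathbb R^2$ has the Euclidean metric. Conformal means that the pullback metric is a nonnegative function times $ds^2+dt^2$; here this function is $2(a+bv(s)+cw(t))\ge 0$ for both maps, so that each of them is an immersion exactly where $a+bv(s)+cw(t)\neq0$. Harmonic means smooth and a critical point of the energy $\int|df|^2\,ds\,dt$ under smooth variations that are constant outside a compact set. -/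

import Mathlib

open scoped ContDiff Topology LinearAlgebra.Projectivization

/-- `ℂ³` with its standard Hermitian structure. -/
abbrev C3 : Type := EuclideanSpace ℂ (Fin 3)

/-- `ℝ²` with its Euclidean structure and Lebesgue measure; its coordinates are `(s, t)`. -/
abbrev R2 : Type := EuclideanSpace ℝ (Fin 2)

/-- The unit sphere `S⁵` of `ℂ³`. -/
abbrev S5 : Type := Metric.sphere (0 : C3) 1

/-- The complex projective plane. -/
abbrev CP2 : Type := ℙ ℂ C3

/-- The Euclidean metric `g(a, b) = Re (a₁ b̄₁ + a₂ b̄₂ + a₃ b̄₃)` of `ℂ³ = ℝ⁶`. -/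
noncomputable def euclG (a b : C3) : ℝ := (inner ℂ a b).re

/-- The Hopf projection `S⁵ → ℂP²`, `x ↦ [x]`. -/
noncomputable def hopf (x : S5) : CP2 :=
  Projectivization.mk ℂ (x : C3) (ne_zero_of_mem_unit_sphere x)

/-! ### Smooth maps into the sphere and pullback of the round metric -/

section Sphere

variable {E : Type*} [NormedAddCommGroup E] [NormedSpace ℝ E]

/-- Smoothness of a map into `S⁵`, a closed submanifold of `ℂ³`. -/
def SmoothS5 (f : E → S5) : Prop := ContDiff ℝ ∞ (fun x => (f x : C3))

/-- The pullback of the round metric of `S⁵` by `f`, at `x`, on the vectors `u`, `u'`. -/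
noncomputable def pullS5 (f : E → S5) (x u u' : E) : ℝ :=
  euclG (fderiv ℝ (fun y => (f y : C3)) x u) (fderiv ℝ (fun y => (f y : C3)) x u')

end Sphere

/-! ### Smooth maps into the projective plane and pullback of the Fubini-Study metric -/

/-- The Fubini-Study metric in homogeneous coordinates, at the point `[p]`, on the images under
`ℂ³ ∖ {0} → ℂP²` of the tangent vectors `ξ`, `η` at `p`:
`Re (⟪ξ, η⟫ |p|² - ⟪ξ, p⟫ ⟪p, η⟫) / |p|⁴`. With this normalization the Hopf projection
from the unit sphere is a Riemannian submersion. -/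
noncomputable def fubiniStudy (p ξ η : C3) : ℝ :=
  (inner ℂ ξ η * inner ℂ p p - inner ℂ ξ p * inner ℂ p η).re / ‖p‖ ^ 4

/-- The metric does not depend on the choice of the homogeneous coordinates. -/
theorem fubiniStudy_invariant (p ξ η : C3) (c a b : ℂ) (hc : c ≠ 0) :
    fubiniStudy (c • p) (c • ξ + a • p) (c • η + b • p) = fubiniStudy p ξ η := by
  have key : inner ℂ (c • ξ + a • p) (c • η + b • p) * inner ℂ (c • p) (c • p)
        - inner ℂ (c • ξ + a • p) (c • p) * inner ℂ (c • p) (c • η + b • p)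
      = ((‖c‖ ^ 4 : ℝ) : ℂ) * (inner ℂ ξ η * inner ℂ p p - inner ℂ ξ p * inner ℂ p η) := by
    have h : ((‖c‖ ^ 4 : ℝ) : ℂ) = ((starRingEnd ℂ) c * c) ^ 2 := by
      rw [Complex.conj_mul']
      push_cast
      ring
    rw [h]
    simp only [inner_add_left, inner_add_right, inner_smul_left, inner_smul_right]
    ring
  have hc' : ‖c‖ ≠ 0 := norm_ne_zero_iff.mpr hc
  unfold fubiniStudy
  rw [key, Complex.re_ofReal_mul, norm_smul, mul_pow]
  exact mul_div_mul_left _ _ (pow_ne_zero 4 hc')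

section Projective

variable {E : Type*} [NormedAddCommGroup E] [NormedSpace ℝ E]

/-- `F` is a smooth lift to `ℂ³ ∖ {0}` (smooth homogeneous coordinates), near the point `x`,
of the map `f` into `ℂP²`. -/
def IsLiftAt (f : E → CP2) (F : E → C3) (x : E) : Prop :=
  ContDiffAt ℝ ∞ F x ∧
    ∀ᶠ y in 𝓝 x, ∃ h : F y ≠ 0, f y = Projectivization.mk ℂ (F y) h

/-- Smoothness of a map into `ℂP²`: near every point it has smooth homogeneous coordinates. -/
def SmoothCP2 (f : E → CP2) : Prop := ∀ x, ∃ F : E → C3, IsLiftAt f F x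

open Classical in
/-- The pullback of the Fubini-Study metric by `f`, at `x`, on the vectors `u`, `u'`, computed in
smooth homogeneous coordinates (any choice gives the same value, see `pullCP2_eq`). -/
noncomputable def pullCP2 (f : E → CP2) (x u u' : E) : ℝ :=
  if h : ∃ F : E → C3, IsLiftAt f F x then
    fubiniStudy (h.choose x) (fderiv ℝ h.choose x u) (fderiv ℝ h.choose x u')
  else 0

/-- Two smooth lifts differ by a smooth nonzero factor, so they give the same pullback. -/
theorem fubiniStudy_lift_eq {f : E → CP2} {F G : E → C3} {x : E}
    (hF : IsLiftAt f F x) (hG : IsLiftAt f G x) (u u' : E) :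
    fubiniStudy (G x) (fderiv ℝ G x u) (fderiv ℝ G x u')
      = fubiniStudy (F x) (fderiv ℝ F x u) (fderiv ℝ F x u') := by
  obtain ⟨hFs, hFe⟩ := hF
  obtain ⟨hGs, hGe⟩ := hG
  have hFd : DifferentiableAt ℝ F x := hFs.differentiableAt (by simp)
  have hGd : DifferentiableAt ℝ G x := hGs.differentiableAt (by simp)
  have hFx : F x ≠ 0 := hFe.self_of_nhds.1
  have hGx : G x ≠ 0 := hGe.self_of_nhds.1
  let L : C3 →L[ℝ] ℂ := (innerSL ℂ (F x)).restrictScalars ℝ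
  have hL : ∀ z, L z = inner ℂ (F x) z := fun z => rfl
  let c : E → ℂ := fun y => L (G y) / L (F y)
  have hLF : L (F x) ≠ 0 := by rw [hL]; exact inner_self_ne_zero.mpr hFx
  have hLFc : ContinuousAt (fun y => L (F y)) x := L.continuous.continuousAt.comp hFd.continuousAt
  have hFL : DifferentiableAt ℝ (fun y => L (F y)) x := L.differentiableAt.comp x hFd
  have hGL : DifferentiableAt ℝ (fun y => L (G y)) x := L.differentiableAt.comp x hGd
  have hcd : DifferentiableAt ℝ c x := by
    simp only [c, div_eq_mul_inv]
    exact hGL.mul (hFL.inv hLF)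
  have hGc : G =ᶠ[𝓝 x] fun y => c y • F y := by
    filter_upwards [hFe, hGe, hLFc.eventually_ne hLF] with y h1 h2 h3
    obtain ⟨h1, e1⟩ := h1
    obtain ⟨h2, e2⟩ := h2
    have e := e2.symm.trans e1
    rw [Projectivization.mk_eq_mk_iff'] at e
    obtain ⟨a, ha⟩ := e
    have hy : L (G y) = a * L (F y) := by
      rw [← ha, hL, hL, inner_smul_right]
    have : c y = a := by
      simp only [c]
      rw [hy, mul_div_cancel_right₀ _ h3]
    rw [this, ha]
  have hGx' : G x = c x • F x := hGc.self_of_nhds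
  have hc : c x ≠ 0 := by
    intro h
    rw [h, zero_smul] at hGx'
    exact hGx hGx'
  have hd : ∀ z, fderiv ℝ G x z = c x • fderiv ℝ F x z + (fderiv ℝ c x z) • F x := by
    intro z
    rw [hGc.fderiv_eq, fderiv_fun_smul hcd hFd]
    rfl
  rw [hd, hd, hGx']
  exact fubiniStudy_invariant _ _ _ _ _ _ hc

theorem pullCP2_eq {f : E → CP2} {F : E → C3} {x : E} (hF : IsLiftAt f F x) (u u' : E) :
    pullCP2 f x u u' = fubiniStudy (F x) (fderiv ℝ F x u) (fderiv ℝ F x u') := by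
  have h : ∃ F : E → C3, IsLiftAt f F x := ⟨F, hF⟩
  rw [pullCP2, dif_pos h]
  exact fubiniStudy_lift_eq hF h.choose_spec u u'

end Projective

/-! ### Conformal and harmonic maps of the plane -/

/-- The pullback metric `h` on `ℝ²` is `lam` times the Euclidean metric, `lam ≥ 0`. A map is
(weakly) conformal if this holds, for some `lam`, of the metric it pulls back; it is an immersion
where `lam > 0`, and its differential is zero where `lam = 0`. -/
def IsConformalWith (h : R2 → R2 → R2 → ℝ) (lam : R2 → ℝ) : Prop :=
  ∀ x, 0 ≤ lam x ∧ ∀ u u', h x u u' = lam x * inner ℝ u u'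

/-- The energy `∫_K |df|²` over `K ⊆ ℝ²` of a map with pullback metric `h`: the density
`|df|²` is the trace of `h`. -/
noncomputable def energyOn (h : R2 → R2 → R2 → ℝ) (K : Set R2) : ℝ :=
  ∫ x in K, ∑ i : Fin 2, h x (EuclideanSpace.single i 1) (EuclideanSpace.single i 1)

/-- `f : ℝ² → S⁵` is harmonic: it is smooth and a critical point of the energy under all smooth
variations `f_ε = g (ε, ·)` of `f = f₀` that are constant outside a compact set `K`. -/
def IsHarmonicS5 (f : R2 → S5) : Prop :=
  SmoothS5 f ∧
    ∀ (g : ℝ × R2 → S5) (K : Set R2), SmoothS5 g → IsCompact K →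
      (∀ x, g (0, x) = f x) → (∀ ε, ∀ x ∉ K, g (ε, x) = f x) →
      HasDerivAt (fun ε => energyOn (pullS5 fun x => g (ε, x)) K) 0 0

/-- `f : ℝ² → ℂP²` is harmonic, for the Fubini-Study metric: it is smooth and a critical point of
the energy under all smooth variations of it that are constant outside a compact set `K`. -/
def IsHarmonicCP2 (f : R2 → CP2) : Prop :=
  SmoothCP2 f ∧
    ∀ (g : ℝ × R2 → CP2) (K : Set R2), SmoothCP2 g → IsCompact K →
      (∀ x, g (0, x) = f x) → (∀ ε, ∀ x ∉ K, g (ε, x) = f x) →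
      HasDerivAt (fun ε => energyOn (pullCP2 fun x => g (ε, x)) K) 0 0

/-! ### The family of maps -/

/-- `(β₁, β₂, β₃)` as a function of `θ`, with indices `0, 1, 2`. -/
noncomputable def coeffBeta (θ : ℝ) : Fin 3 → ℝ :=
  ![1 / √2 * Real.cos θ - 1 / √6 * Real.sin θ,
    -(1 / √2) * Real.cos θ - 1 / √6 * Real.sin θ,
    2 / √6 * Real.sin θ]

/-- `(γ₁, γ₂, γ₃)` as a function of `θ`, with indices `0, 1, 2`. -/
noncomputable def coeffGamma (θ : ℝ) : Fin 3 → ℝ :=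
  ![-(1 / √6) * Real.cos θ - 1 / √2 * Real.sin θ,
    -(1 / √6) * Real.cos θ + 1 / √2 * Real.sin θ,
    2 / √6 * Real.cos θ]

/-- `Φ(r, s, t) = (1/√3) (r y₁(s) z₁(t), r y₂(s) z₂(t), r y₃(s) z₃(t))`. -/
noncomputable def mapPhi (y z : Fin 3 → ℝ → ℂ) (r s t : ℝ) : C3 :=
  WithLp.toLp 2 fun j => ((1 / √3 : ℝ) : ℂ) * ((r : ℂ) * y j s * z j t)

/-! ### Algebraic identities of the coefficients. -/

section Coefficients

/-! The vectors (1,1,1)/√3, β, γ form an orthonormal basis of ℝ³; all the algebra rests on the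
orthogonality of the matrix they form (`CoeffRel`). In the Hermitian products of Φ with Φ_s and Φ_t,
and of Φ_s with Φ_t, the equations turn the j-th term into a factor independent of j, such as conj
(y₁y₂y₃), times β_j|z_j|², γ_j|y_j|² or β_jγ_j. The sums over j vanish, so these products are zero
over ℂ and not only in their real parts. The squared lengths become polynomials in v and w, reduced
by the cubic identities for β and γ (`inner_vel_self`).

Differentiating the system again gives y_j'' = (-β_j² + 2β₁β₂β₃v) y_j, and similarly for z_j. As
β_j² + γ_j² = 2/3, the Laplacian of φ is mφ with m real and independent of j (`laplacian_planeMap`).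

The first variation of the Dirichlet energy along W is -2∫⟨Δφ, W⟩, which is zero when W ⟂ φ
(`hasDerivAt_energy_eq_zero`). In S⁵ this orthogonality is the derivative of |g|² = 1. In ℂP² a
variation is lifted to G with ⟨φ, G⟩ = 1, so that W is Hermitian-orthogonal to φ; since φ is
horizontal, the Fubini-Study density then has the same first variation as the flat one
(`hasDerivAt_fubiniStudy`). -/

theorem coeffBeta_add_eq_zero (θ : ℝ) : coeffBeta θ 0 + coeffBeta θ 1 + coeffBeta θ 2 = 0 := by
  simp [coeffBeta]
  ring

theorem coeffGamma_add_eq_zero (θ : ℝ) : coeffGamma θ 0 + coeffGamma θ 1 + coeffGamma θ 2 = 0 := by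
  simp [coeffGamma]
  ring

theorem one_div_sqrt_sq {x : ℝ} (hx : 0 ≤ x) : (1 / √x) ^ 2 = 1 / x := by
  rw [div_pow, Real.sq_sqrt hx, one_pow]

theorem coeffBeta_sq_add_coeffGamma_sq (θ : ℝ) (j : Fin 3) :
    coeffBeta θ j ^ 2 + coeffGamma θ j ^ 2 = 2 / 3 := by
  have h2 := one_div_sqrt_sq (x := 2) (by norm_num)
  have h6 := one_div_sqrt_sq (x := 6) (by norm_num)
  have h6' : 2 / √(6 : ℝ) = 2 * (1 / √6) := by ring
  have hθ := Real.sin_sq_add_cos_sq θ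
  fin_cases j <;> simp only [coeffBeta, coeffGamma, h6', Fin.isValue, Fin.zero_eta, Fin.mk_one,
    Fin.reduceFinMk, Matrix.cons_val] <;>
    -- Only p² = 1/2 and q² = 1/6 matter from here on: the claim is a polynomial identity in p, q,
    -- cos θ, sin θ.
    generalize 1 / √(2 : ℝ) = p at * <;> generalize 1 / √(6 : ℝ) = q at * <;> grind

theorem sum_coeffBeta_sq (θ : ℝ) :
    coeffBeta θ 0 ^ 2 + coeffBeta θ 1 ^ 2 + coeffBeta θ 2 ^ 2 = 1 := by
  have h2 := one_div_sqrt_sq (x := 2) (by norm_num)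
  have h6 := one_div_sqrt_sq (x := 6) (by norm_num)
  have h6' : 2 / √(6 : ℝ) = 2 * (1 / √6) := by ring
  have hθ := Real.sin_sq_add_cos_sq θ
  simp only [coeffBeta, h6', Fin.isValue, Matrix.cons_val]
  generalize 1 / √(2 : ℝ) = p at *
  generalize 1 / √(6 : ℝ) = q at *
  grind

theorem sum_coeffBeta_mul_coeffGamma (θ : ℝ) :
    coeffBeta θ 0 * coeffGamma θ 0 + coeffBeta θ 1 * coeffGamma θ 1
      + coeffBeta θ 2 * coeffGamma θ 2 = 0 := by
  have h2 := one_div_sqrt_sq (x := 2) (by norm_num)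
  have h6 := one_div_sqrt_sq (x := 6) (by norm_num)
  have h6' : 2 / √(6 : ℝ) = 2 * (1 / √6) := by ring
  simp only [coeffBeta, coeffGamma, h6', Fin.isValue, Matrix.cons_val]
  generalize 1 / √(2 : ℝ) = p at *
  generalize 1 / √(6 : ℝ) = q at *
  grind

/-- The identities between the two coefficient vectors which the geometry of the map rests on. -/
structure CoeffRel (β γ : Fin 3 → ℝ) : Prop where
  sum_left : β 0 + β 1 + β 2 = 0
  sum_right : γ 0 + γ 1 + γ 2 = 0
  sq_left : β 0 ^ 2 + β 1 ^ 2 + β 2 ^ 2 = 1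
  sq_add : ∀ j, β j ^ 2 + γ j ^ 2 = 2 / 3
  orth : β 0 * γ 0 + β 1 * γ 1 + β 2 * γ 2 = 0

theorem coeffRel (θ : ℝ) : CoeffRel (coeffBeta θ) (coeffGamma θ) :=
  ⟨coeffBeta_add_eq_zero θ, coeffGamma_add_eq_zero θ, sum_coeffBeta_sq θ,
    coeffBeta_sq_add_coeffGamma_sq θ, sum_coeffBeta_mul_coeffGamma θ⟩

namespace CoeffRel

variable {β γ : Fin 3 → ℝ}

/-- The roles of (β, y, v) and (γ, z, w) can be exchanged, so each fact about s also gives the one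
about t. -/
theorem symm (h : CoeffRel β γ) : CoeffRel γ β where
  sum_left := h.sum_right
  sum_right := h.sum_left
  sq_left := by linear_combination h.sq_add 0 + h.sq_add 1 + h.sq_add 2 - h.sq_left
  sq_add j := by linear_combination h.sq_add j
  orth := by linear_combination h.orth

theorem cube_sum (h : CoeffRel β γ) :
    β 0 ^ 3 + β 1 ^ 3 + β 2 ^ 3 = 3 * (β 0 * β 1 * β 2) := by
  linear_combination (β 0 ^ 2 + β 1 ^ 2 + β 2 ^ 2 - β 0 * β 1 - β 1 * β 2 - β 2 * β 0) * h.sum_left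

theorem mixed_sum (h : CoeffRel β γ) :
    β 0 * γ 0 ^ 2 + β 1 * γ 1 ^ 2 + β 2 * γ 2 ^ 2 = -(3 * (β 0 * β 1 * β 2)) := by
  linear_combination β 0 * h.sq_add 0 + β 1 * h.sq_add 1 + β 2 * h.sq_add 2 - h.cube_sum
    + 2 / 3 * h.sum_left

/-- The elementary symmetric functions of β are 0, -1/2 and β₀β₁β₂, so each β_j is a root of X³ -
X/2 - β₀β₁β₂. -/
theorem cube (h : CoeffRel β γ) (j : Fin 3) : β j ^ 3 = β j / 2 + β 0 * β 1 * β 2 := by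
  have h0 := h.sum_left
  have h1 := h.sq_left
  have e : β 2 = -β 0 - β 1 := by linear_combination h0
  fin_cases j <;> simp only [Fin.isValue, Fin.zero_eta, Fin.mk_one, Fin.reduceFinMk] <;>
    rw [e] at h1 ⊢
  · linear_combination β 0 / 2 * h1
  · linear_combination β 1 / 2 * h1
  · linear_combination -(β 0 + β 1) / 2 * h1

theorem cube_mul_sum (h : CoeffRel β γ) :
    β 0 ^ 3 * γ 0 + β 1 ^ 3 * γ 1 + β 2 ^ 3 * γ 2 = 0 := by
  rw [h.cube 0, h.cube 1, h.cube 2]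
  linear_combination 1 / 2 * h.orth + β 0 * β 1 * β 2 * h.sum_right

end CoeffRel

end Coefficients

/-! ### The product map, its Hermitian products and its derivatives. -/

section MapPhi

theorem mapPhi_apply (y z : Fin 3 → ℝ → ℂ) (r s t : ℝ) (j : Fin 3) :
    mapPhi y z r s t j = ((1 / √3 : ℝ) : ℂ) * ((r : ℂ) * y j s * z j t) := rfl

theorem inner_mapPhi (y z y' z' : Fin 3 → ℝ → ℂ) (r s t r' : ℝ) :
    inner ℂ (mapPhi y z r s t) (mapPhi y' z' r' s t)
      = (1 / 3 * r * r' : ℂ) * ∑ j, (starRingEnd ℂ) (y j s * z j t) * (y' j s * z' j t) := by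
  have h3 : ((1 / √3 : ℝ) : ℂ) ^ 2 = 1 / 3 := by
    rw [← Complex.ofReal_pow, one_div_sqrt_sq (by norm_num)]
    norm_num
  rw [PiLp.inner_apply, Finset.mul_sum, ← h3]
  refine Finset.sum_congr rfl fun j _ => ?_
  simp only [RCLike.inner_apply, mapPhi_apply, map_mul, Complex.conj_ofReal]
  ring

theorem C3.hasFDerivAt_of_apply {E : Type*} [NormedAddCommGroup E] [NormedSpace ℝ E] {f : E → C3}
    {f' : E →L[ℝ] C3} {x : E} (h : ∀ j, HasFDerivAt (fun x => f x j)
      ((PiLp.proj 2 (fun _ : Fin 3 => ℂ) j : C3 →L[ℝ] ℂ) ∘L f') x) : HasFDerivAt f f' x := by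
  rw [← hasFDerivWithinAt_univ, hasFDerivWithinAt_piLp]
  exact fun j => (h j).hasFDerivWithinAt

theorem C3.hasDerivAt_of_apply {f : ℝ → C3} {f' : C3} {x : ℝ}
    (h : ∀ j, HasDerivAt (fun x => f x j) (f' j) x) : HasDerivAt f f' x := by
  refine C3.hasFDerivAt_of_apply fun j => (h j).hasFDerivAt.congr_fderiv ?_
  ext
  simp

/-- `mapPhi` is trilinear in (r, y, z), so its partial derivatives are again of the form `mapPhi`,
and `inner_mapPhi` covers all their products. -/
theorem hasDerivAt_mapPhi {y z : Fin 3 → ℝ → ℂ} {r s t : ℝ → ℝ} {y' z' : Fin 3 → ℝ → ℂ}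
    {r' s' t' x : ℝ} (hy : ∀ j, HasDerivAt (y j) (y' j (s x)) (s x))
    (hz : ∀ j, HasDerivAt (z j) (z' j (t x)) (t x))
    (hr : HasDerivAt r r' x) (hs : HasDerivAt s s' x) (ht : HasDerivAt t t' x) :
    HasDerivAt (fun x => mapPhi y z (r x) (s x) (t x))
      (mapPhi y z r' (s x) (t x) + s' • mapPhi y' z (r x) (s x) (t x)
        + t' • mapPhi y z' (r x) (s x) (t x)) x := by
  refine C3.hasDerivAt_of_apply fun j => ?_
  have h1 := (hy j).scomp x hs
  have h2 := (hz j).scomp x ht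
  have h3 := ((hr.ofReal_comp.mul h1).mul h2).const_mul ((1 / √3 : ℝ) : ℂ)
  refine h3.congr_deriv ?_
  simp only [PiLp.add_apply, PiLp.smul_apply, mapPhi_apply, Complex.real_smul,
    Function.comp_apply, Pi.mul_apply]
  ring

theorem contDiff_mapPhi {E : Type*} [NormedAddCommGroup E] [NormedSpace ℝ E]
    {y z : Fin 3 → ℝ → ℂ} {r s t : E → ℝ} {n : ℕ∞ω}
    (hy : ∀ j, ContDiff ℝ n (y j)) (hz : ∀ j, ContDiff ℝ n (z j))
    (hr : ContDiff ℝ n r) (hs : ContDiff ℝ n s) (ht : ContDiff ℝ n t) :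
    ContDiff ℝ n (fun x => mapPhi y z (r x) (s x) (t x)) := by
  refine contDiff_piLp' (p := 2) fun j => ?_
  have hr' : ContDiff ℝ n (fun x => (r x : ℂ)) := Complex.ofRealCLM.contDiff.comp hr
  exact contDiff_const.mul ((hr'.mul ((hy j).comp hs)).mul ((hz j).comp ht))

theorem hasFDerivAt_mapPhi {y z y' z' : Fin 3 → ℝ → ℂ} {r : ℝ} {x : R2}
    (hy : ∀ j s, HasDerivAt (y j) (y' j s) s) (hz : ∀ j t, HasDerivAt (z j) (z' j t) t) :
    HasFDerivAt (fun x : R2 => mapPhi y z r (x 0) (x 1))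
      ((EuclideanSpace.proj (𝕜 := ℝ) (0 : Fin 2)).smulRight (mapPhi y' z r (x 0) (x 1))
        + (EuclideanSpace.proj (𝕜 := ℝ) (1 : Fin 2)).smulRight (mapPhi y z' r (x 0) (x 1))) x := by
  refine C3.hasFDerivAt_of_apply fun j => ?_
  have hc (i : Fin 2) : HasFDerivAt (fun x : R2 => x i) (EuclideanSpace.proj i : R2 →L[ℝ] ℝ) x :=
    (EuclideanSpace.proj i : R2 →L[ℝ] ℝ).hasFDerivAt
  have h1 := HasFDerivAt.comp (f := fun x : R2 => x 0) x (hy j (x 0)).hasFDerivAt (hc 0)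
  have h2 := HasFDerivAt.comp (f := fun x : R2 => x 1) x (hz j (x 1)).hasFDerivAt (hc 1)
  have h3 := (((hasFDerivAt_const (r : ℂ) x).mul h1).mul h2).const_mul ((1 / √3 : ℝ) : ℂ)
  refine h3.congr_fderiv ?_
  ext u
  simp [mapPhi_apply]
  ring

theorem fderiv_mapPhi {y z y' z' : Fin 3 → ℝ → ℂ} (r : ℝ) (x u : R2)
    (hy : ∀ j s, HasDerivAt (y j) (y' j s) s) (hz : ∀ j t, HasDerivAt (z j) (z' j t) t) :
    fderiv ℝ (fun x : R2 => mapPhi y z r (x 0) (x 1)) x u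
      = u 0 • mapPhi y' z r (x 0) (x 1) + u 1 • mapPhi y z' r (x 0) (x 1) := by
  rw [(hasFDerivAt_mapPhi hy hz).fderiv]
  rfl

end MapPhi

/-! ### Regularity and second derivatives of the solutions of the system. -/

section TripleSystem

/-- The solutions `y` of the system `dy_j/ds = β_j conj (y_{j+1} y_{j+2})` with
`|y_j|² = β_j v + 1`. -/
structure IsTriple (β : Fin 3 → ℝ) (y : Fin 3 → ℝ → ℂ) (v : ℝ → ℝ) : Prop where
  deriv : ∀ j s, HasDerivAt (y j) ((β j : ℂ) * (starRingEnd ℂ) (y (j + 1) s * y (j + 2) s)) s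
  norm : ∀ j s, ‖y j s‖ ^ 2 = β j * v s + 1

/-- The velocity of the system. -/
noncomputable def tripleVel (β : Fin 3 → ℝ) (y : Fin 3 → ℝ → ℂ) : Fin 3 → ℝ → ℂ :=
  fun j s => (β j : ℂ) * (starRingEnd ℂ) (y (j + 1) s * y (j + 2) s)

namespace IsTriple

variable {β : Fin 3 → ℝ} {y : Fin 3 → ℝ → ℂ} {v : ℝ → ℝ}

theorem hasDerivAt (h : IsTriple β y v) (j : Fin 3) (s : ℝ) :
    HasDerivAt (y j) (tripleVel β y j s) s := h.deriv j s

/-- Bootstrapping: the derivative is a polynomial in the conjugates of the other components, so Cⁿ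
for all j implies Cⁿ⁺¹. -/
theorem contDiff (h : IsTriple β y v) (j : Fin 3) : ContDiff ℝ ∞ (y j) := by
  rw [contDiff_infty]
  intro n
  induction n generalizing j with
  | zero =>
    exact contDiff_zero.2 (continuous_iff_continuousAt.2 fun s => (h.deriv j s).continuousAt)
  | succ n ih =>
    have hd : _root_.deriv (y j) = tripleVel β y j := funext fun s => (h.deriv j s).deriv
    push_cast
    rw [contDiff_succ_iff_deriv]
    refine ⟨fun s => (h.deriv j s).differentiableAt, by simp, ?_⟩
    rw [hd]
    exact contDiff_const.mul (Complex.conjCLE.contDiff.comp ((ih _).mul (ih _)))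

theorem conj_mul (h : IsTriple β y v) (j : Fin 3) (s : ℝ) :
    (starRingEnd ℂ) (y j s) * y j s = β j * v s + 1 := by
  rw [Complex.conj_mul', ← Complex.ofReal_pow, h.norm]
  push_cast
  rfl

/-- Differentiating conj (y_{j+1} y_{j+2}) brings back y_j times |y_{j+2}|² and |y_{j+1}|², which
are affine in v; β_{j+1} + β_{j+2} = -β_j gives the term -β_j². -/
theorem hasDerivAt_vel (h : IsTriple β y v) (h0 : β 0 + β 1 + β 2 = 0) (j : Fin 3) (s : ℝ) :
    HasDerivAt (tripleVel β y j)
      (((-β j ^ 2 + 2 * (β 0 * β 1 * β 2) * v s : ℝ) : ℂ) * y j s) s := by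
  have h1 := ((((h.deriv (j + 1) s).mul (h.deriv (j + 2) s)).hasFDerivAt.star.hasDerivAt).const_mul
    (β j : ℂ))
  have e : ((β 0 : ℂ)) + β 1 + β 2 = 0 := by exact_mod_cast h0
  have e0 := h.conj_mul 0 s
  have e1 := h.conj_mul 1 s
  have e2 := h.conj_mul 2 s
  refine h1.congr_deriv ?_
  fin_cases j
  · simp
    linear_combination (β 0 : ℂ) * y 0 s * (β 1 * e2 + β 2 * e1 + e)
  · simp
    linear_combination (β 1 : ℂ) * y 1 s * (β 2 * e0 + β 0 * e2 + e)
  · simp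
    linear_combination (β 2 : ℂ) * y 2 s * (β 0 * e1 + β 1 * e0 + e)

end IsTriple

end TripleSystem

/-! ### Metric and Laplacian of the map. -/

section Geometry

theorem mapPhi_comm (y z : Fin 3 → ℝ → ℂ) (r s t : ℝ) : mapPhi y z r s t = mapPhi z y r t s := by
  ext j
  simp only [mapPhi_apply]
  ring

variable {β γ : Fin 3 → ℝ} {y z : Fin 3 → ℝ → ℂ} {v w : ℝ → ℝ}

theorem inner_mapPhi_self (h : CoeffRel β γ) (hy : IsTriple β y v) (hz : IsTriple γ z w)
    (r r' s t : ℝ) : inner ℂ (mapPhi y z r s t) (mapPhi y z r' s t) = (r * r' : ℂ) := by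
  have e (j) : (starRingEnd ℂ) (y j s * z j t) * (y j s * z j t)
      = (((β j * v s + 1) * (γ j * w t + 1) : ℝ) : ℂ) := by
    rw [map_mul, mul_mul_mul_comm, hy.conj_mul, hz.conj_mul]
    push_cast
    rfl
  have k : ∑ j, (β j * v s + 1) * (γ j * w t + 1) = 3 := by
    rw [Fin.sum_univ_three]
    linear_combination v s * w t * h.orth + v s * h.sum_left + w t * h.sum_right
  rw [inner_mapPhi, Finset.sum_congr rfl fun j _ => e j, ← Complex.ofReal_sum, k]
  push_cast
  ring

theorem inner_mapPhi_vel (h : CoeffRel β γ) (hz : IsTriple γ z w) (r r' s t : ℝ) :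
    inner ℂ (mapPhi y z r s t) (mapPhi (tripleVel β y) z r' s t) = 0 := by
  have e0 := hz.conj_mul 0 t
  have e1 := hz.conj_mul 1 t
  have e2 := hz.conj_mul 2 t
  have k1 : (β 0 : ℂ) + β 1 + β 2 = 0 := by exact_mod_cast h.sum_left
  have k2 : (β 0 : ℂ) * γ 0 + β 1 * γ 1 + β 2 * γ 2 = 0 := by exact_mod_cast h.orth
  rw [inner_mapPhi, mul_eq_zero, Fin.sum_univ_three]
  right
  simp only [tripleVel, map_mul, Fin.isValue, zero_add, Fin.reduceAdd]
  linear_combination (starRingEnd ℂ) (y 0 s) * (starRingEnd ℂ) (y 1 s) * (starRingEnd ℂ) (y 2 s) *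
    (β 0 * e0 + β 1 * e1 + β 2 * e2 + w t * k2 + k1)

theorem inner_mapPhi_vel_right (h : CoeffRel β γ) (hy : IsTriple β y v) (r r' s t : ℝ) :
    inner ℂ (mapPhi y z r s t) (mapPhi y (tripleVel γ z) r' s t) = 0 := by
  rw [mapPhi_comm y z, mapPhi_comm y, inner_mapPhi_vel h.symm hy]

theorem inner_mapPhi_vel_vel (h : CoeffRel β γ) (r r' s t : ℝ) :
    inner ℂ (mapPhi (tripleVel β y) z r s t) (mapPhi y (tripleVel γ z) r' s t) = 0 := by
  have k2 : (β 0 : ℂ) * γ 0 + β 1 * γ 1 + β 2 * γ 2 = 0 := by exact_mod_cast h.orth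
  rw [inner_mapPhi, mul_eq_zero, Fin.sum_univ_three]
  right
  simp only [tripleVel, map_mul, Fin.isValue, zero_add, Fin.reduceAdd, Complex.conj_conj,
    Complex.conj_ofReal]
  linear_combination y 0 s * y 1 s * y 2 s * (starRingEnd ℂ) (z 0 t) * (starRingEnd ℂ) (z 1 t)
    * (starRingEnd ℂ) (z 2 t) * k2

theorem inner_vel_self (h : CoeffRel β γ) (hy : IsTriple β y v) (hz : IsTriple γ z w)
    (r s t : ℝ) :
    inner ℂ (mapPhi (tripleVel β y) z r s t) (mapPhi (tripleVel β y) z r s t)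
      = ((r ^ 2 * (1 / 3 - β 0 * β 1 * β 2 * v s - γ 0 * γ 1 * γ 2 * w t) : ℝ) : ℂ) := by
  have e (j) : (starRingEnd ℂ) (tripleVel β y j s * z j t) * (tripleVel β y j s * z j t)
      = ((β j ^ 2 * ((β (j + 1) * v s + 1) * (β (j + 2) * v s + 1)) * (γ j * w t + 1) : ℝ) : ℂ) := by
    have e1 := hy.conj_mul (j + 1) s
    have e2 := hy.conj_mul (j + 2) s
    have e3 := hz.conj_mul j t
    push_cast
    rw [← e1, ← e2, ← e3]
    simp only [tripleVel, map_mul, Complex.conj_conj, Complex.conj_ofReal]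
    ring
  have k : ∑ j, β j ^ 2 * ((β (j + 1) * v s + 1) * (β (j + 2) * v s + 1)) * (γ j * w t + 1)
      = 1 - 3 * (β 0 * β 1 * β 2) * v s - 3 * (γ 0 * γ 1 * γ 2) * w t := by
    rw [Fin.sum_univ_three]
    simp only [Fin.isValue, zero_add, Fin.reduceAdd]
    -- As Σβ_j = 0, the factor (β_{j+1}v + 1)(β_{j+2}v + 1) is β_{j+1}β_{j+2}v² - β_jv + 1. The v²
    -- part sums to a multiple of Σβ_j(γ_jw + 1) = 0, and the cubic identities evaluate the rest.
    linear_combination h.sq_left + w t * h.symm.mixed_sum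
      + v s * (β 0 ^ 2 * (γ 0 * w t + 1) + β 1 ^ 2 * (γ 1 * w t + 1)
        + β 2 ^ 2 * (γ 2 * w t + 1)) * h.sum_left
      - v s * h.cube_sum - v s * w t * h.cube_mul_sum
      + v s ^ 2 * (β 0 * β 1 * β 2) * (w t * h.orth + h.sum_left)
  rw [inner_mapPhi, Finset.sum_congr rfl fun j _ => e j, ← Complex.ofReal_sum, k]
  push_cast
  ring

theorem inner_vel_right_self (h : CoeffRel β γ) (hy : IsTriple β y v) (hz : IsTriple γ z w)
    (r s t : ℝ) :
    inner ℂ (mapPhi y (tripleVel γ z) r s t) (mapPhi y (tripleVel γ z) r s t)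
      = ((r ^ 2 * (1 / 3 - β 0 * β 1 * β 2 * v s - γ 0 * γ 1 * γ 2 * w t) : ℝ) : ℂ) := by
  rw [mapPhi_comm y, inner_vel_self h.symm hz hy]
  congr 1
  ring

theorem norm_sq_eq_of_inner_self {x : C3} {ρ : ℝ} (h : inner ℂ x x = (ρ : ℂ)) : ‖x‖ ^ 2 = ρ := by
  have := inner_self_eq_norm_sq (𝕜 := ℂ) x
  rw [h] at this
  simpa using this.symm

/-- The map of the plane given by a pair of triples, at `r = 1`. -/
noncomputable def planeMap (y z : Fin 3 → ℝ → ℂ) (x : R2) : C3 := mapPhi y z 1 (x 0) (x 1)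

theorem contDiff_planeMap (hy : IsTriple β y v) (hz : IsTriple γ z w) :
    ContDiff ℝ ∞ (planeMap y z) :=
  contDiff_mapPhi hy.contDiff hz.contDiff contDiff_const (contDiff_piLp_apply (p := 2))
    (contDiff_piLp_apply (p := 2))

theorem fderiv_planeMap {y' z' : Fin 3 → ℝ → ℂ} (hy : ∀ j s, HasDerivAt (y j) (y' j s) s)
    (hz : ∀ j t, HasDerivAt (z j) (z' j t) t) (x u : R2) :
    fderiv ℝ (planeMap y z) x u = u 0 • planeMap y' z x + u 1 • planeMap y z' x :=
  fderiv_mapPhi 1 x u hy hz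

theorem norm_planeMap (h : CoeffRel β γ) (hy : IsTriple β y v) (hz : IsTriple γ z w) (x : R2) :
    ‖planeMap y z x‖ = 1 := by
  have e := norm_sq_eq_of_inner_self (x := planeMap y z x) (ρ := 1) <| by
    rw [planeMap, inner_mapPhi_self h hy hz]
    simp
  exact (pow_eq_one_iff_of_nonneg (norm_nonneg _) two_ne_zero).1 e

/-- Horizontality for the Hopf projection: this is what lets one lift serve both targets. -/
theorem inner_planeMap_fderiv (h : CoeffRel β γ) (hy : IsTriple β y v) (hz : IsTriple γ z w)
    (x u : R2) : inner ℂ (planeMap y z x) (fderiv ℝ (planeMap y z) x u) = 0 := by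
  rw [fderiv_planeMap hy.hasDerivAt hz.hasDerivAt, inner_add_right, inner_smul_right_eq_smul,
    inner_smul_right_eq_smul]
  have e1 := inner_mapPhi_vel (y := y) h hz 1 1 (x 0) (x 1)
  have e2 := inner_mapPhi_vel_right (z := z) h hy 1 1 (x 0) (x 1)
  rw [show inner ℂ (planeMap y z x) (planeMap _ z x) = 0 from e1,
    show inner ℂ (planeMap y z x) (planeMap y _ x) = 0 from e2]
  simp

theorem inner_fderiv_planeMap (h : CoeffRel β γ) (hy : IsTriple β y v) (hz : IsTriple γ z w)
    (x u u' : R2) :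
    inner ℂ (fderiv ℝ (planeMap y z) x u) (fderiv ℝ (planeMap y z) x u')
      = (((1 / 3 - β 0 * β 1 * β 2 * v (x 0) - γ 0 * γ 1 * γ 2 * w (x 1)) * inner ℝ u u' : ℝ) : ℂ) := by
  have e0 : inner ℂ (planeMap (tripleVel β y) z x) (planeMap y (tripleVel γ z) x) = 0 :=
    inner_mapPhi_vel_vel h 1 1 (x 0) (x 1)
  have e0' : inner ℂ (planeMap y (tripleVel γ z) x) (planeMap (tripleVel β y) z x) = 0 :=
    inner_eq_zero_symm.1 e0
  have e1 := inner_vel_self h hy hz 1 (x 0) (x 1)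
  have e2 := inner_vel_right_self h hy hz 1 (x 0) (x 1)
  rw [fderiv_planeMap hy.hasDerivAt hz.hasDerivAt, fderiv_planeMap hy.hasDerivAt hz.hasDerivAt]
  change inner ℂ (u 0 • planeMap (tripleVel β y) z x + u 1 • planeMap y (tripleVel γ z) x)
    (u' 0 • planeMap (tripleVel β y) z x + u' 1 • planeMap y (tripleVel γ z) x) = _
  simp only [inner_add_left, inner_add_right, inner_smul_right_eq_smul, inner_smul_left_eq_smul,
    e0, e0', smul_zero, zero_add, add_zero]
  rw [planeMap, planeMap, e1, e2]
  simp only [PiLp.inner_apply, Fin.sum_univ_two, Complex.real_smul, RCLike.inner_apply, conj_trivial]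
  push_cast
  ring

/-- The Laplacian of the map is a multiple of the map. -/
theorem laplacian_planeMap (h : CoeffRel β γ) (hy : IsTriple β y v) (hz : IsTriple γ z w) (x : R2) :
    ∃ m : ℝ, ∑ i : Fin 2, fderiv ℝ (fun x => fderiv ℝ (planeMap y z) x (EuclideanSpace.single i 1)) x
      (EuclideanSpace.single i 1) = m • planeMap y z x := by
  -- The sum of the factors in y_j'' and z_j''; j enters only through -(β_j² + γ_j²) = -2/3.
  refine ⟨(-2 / 3 + 2 * (β 0 * β 1 * β 2) * v (x 0) + 2 * (γ 0 * γ 1 * γ 2) * w (x 1)), ?_⟩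
  have d0 : (fun x => fderiv ℝ (planeMap y z) x (EuclideanSpace.single 0 1))
      = planeMap (tripleVel β y) z := by
    funext x
    rw [fderiv_planeMap hy.hasDerivAt hz.hasDerivAt]
    simp
  have d1 : (fun x => fderiv ℝ (planeMap y z) x (EuclideanSpace.single 1 1))
      = planeMap y (tripleVel γ z) := by
    funext x
    rw [fderiv_planeMap hy.hasDerivAt hz.hasDerivAt]
    simp
  rw [Fin.sum_univ_two, d0, d1, fderiv_planeMap (hy.hasDerivAt_vel h.sum_left) hz.hasDerivAt,
    fderiv_planeMap hy.hasDerivAt (hz.hasDerivAt_vel h.sum_right)]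
  ext j
  have k : ((β j : ℂ) ^ 2 + (γ j : ℂ) ^ 2) = 2 / 3 := by
    have := congrArg Complex.ofReal (h.sq_add j)
    push_cast at this
    exact this
  simp [planeMap, mapPhi_apply]
  linear_combination -(((√3 : ℝ) : ℂ)⁻¹ * y j (x 0) * z j (x 1)) * k

end Geometry

/-! ### Differentiation of energy integrals and integration by parts. -/

section Variation

open MeasureTheory Set

theorem euclG_eq_inner_real (a b : C3) : euclG a b = inner ℝ a b := by
  rw [euclG, PiLp.inner_apply, PiLp.inner_apply, Complex.re_sum]
  rfl

/-- Differentiation under the integral sign over a compact set. -/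
theorem hasDerivAt_setIntegral_of_contDiffOn {E : Type*} [NormedAddCommGroup E] [NormedSpace ℝ E]
    [MeasurableSpace E] [BorelSpace E] {μ : Measure E} [IsFiniteMeasureOnCompacts μ]
    {e : ℝ × E → ℝ} {δ : ℝ} (hδ : 0 < δ) {K : Set E} (hK : IsCompact K)
    (he : ContDiffOn ℝ 1 e (Metric.ball 0 δ ×ˢ univ)) :
    HasDerivAt (fun ε => ∫ x in K, e (ε, x) ∂μ) (∫ x in K, fderiv ℝ e (0, x) (1, 0) ∂μ) 0 := by
  have ho : IsOpen (Metric.ball (0 : ℝ) δ ×ˢ (univ : Set E)) := Metric.isOpen_ball.prod isOpen_univ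
  have hd : ContinuousOn (fun p => fderiv ℝ e p (1, 0)) (Metric.ball 0 δ ×ˢ univ) :=
    (he.continuousOn_fderiv_of_isOpen ho le_rfl).clm_apply continuousOn_const
  -- Halving the radius leaves a compact set inside the domain, where the derivative has a constant
  -- bound to dominate it.
  have hsub : Metric.closedBall (0 : ℝ) (δ / 2) ×ˢ K ⊆ Metric.ball 0 δ ×ˢ univ :=
    prod_mono (Metric.closedBall_subset_ball (by linarith)) (subset_univ _)
  obtain ⟨C, hC⟩ := ((isCompact_closedBall (0 : ℝ) (δ / 2)).prod hK).exists_bound_of_continuousOn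
    (hd.mono hsub)
  have hslice {g : ℝ × E → ℝ} (hg : ContinuousOn g (Metric.ball 0 δ ×ˢ univ)) {ε : ℝ}
      (hε : ε ∈ Metric.ball (0 : ℝ) δ) : IntegrableOn (fun x => g (ε, x)) K μ := by
    refine ContinuousOn.integrableOn_compact hK ?_
    exact hg.comp (Continuous.prodMk_right ε).continuousOn fun x _ => ⟨hε, mem_univ _⟩
  have h0 : (0 : ℝ) ∈ Metric.ball (0 : ℝ) δ := Metric.mem_ball_self hδ
  refine (hasDerivAt_integral_of_dominated_loc_of_deriv_le (s := Metric.ball 0 (δ / 2))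
    (F := fun ε x => e (ε, x)) (F' := fun ε x => fderiv ℝ e (ε, x) (1, 0)) (bound := fun _ => C)
    (Metric.ball_mem_nhds _ (by linarith)) ?_ (hslice he.continuousOn h0)
    (hslice hd h0).aestronglyMeasurable ?_ ?_ ?_).2
  · filter_upwards [Metric.ball_mem_nhds (0 : ℝ) hδ] with ε hε
    exact (hslice he.continuousOn hε).aestronglyMeasurable
  · filter_upwards [ae_restrict_mem hK.measurableSet] with x hx ε hε
    exact hC (ε, x) ⟨Metric.ball_subset_closedBall hε, hx⟩
  · exact integrableOn_const hK.measure_lt_top.ne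
  · refine ae_of_all _ fun x ε hε => ?_
    have hm : (ε, x) ∈ Metric.ball (0 : ℝ) δ ×ˢ (univ : Set E) :=
      ⟨Metric.ball_subset_ball (by linarith) hε, mem_univ _⟩
    have h1 : HasFDerivAt e (fderiv ℝ e (ε, x)) (ε, x) :=
      ((he.contDiffAt (ho.mem_nhds hm)).differentiableAt one_ne_zero).hasFDerivAt
    exact h1.comp_hasDerivAt ε ((hasDerivAt_id ε).prodMk (hasDerivAt_const ε x))

/-- Green's formula for a map whose Laplacian is pointwise orthogonal to `W`. -/
theorem setIntegral_fderiv_inner_fderiv_eq_zero {f W : R2 → C3} {K : Set R2} (hK : IsCompact K)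
    (hf : ContDiff ℝ ∞ f) (hW : ContDiff ℝ ∞ W) (hWK : ∀ x ∉ K, W x = 0)
    (hfW : ∀ x, inner ℝ (∑ i : Fin 2, fderiv ℝ
      (fun x => fderiv ℝ f x (EuclideanSpace.single i 1)) x (EuclideanSpace.single i 1)) (W x) = 0) :
    ∫ x in K, ∑ i : Fin 2, inner ℝ (fderiv ℝ f x (EuclideanSpace.single i 1))
      (fderiv ℝ W x (EuclideanSpace.single i 1)) = 0 := by
  have hWc : HasCompactSupport W := HasCompactSupport.intro hK hWK
  have hdW (x) (hx : x ∉ K) : fderiv ℝ W x = 0 := by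
    have : W =ᶠ[𝓝 x] fun _ => 0 := by
      filter_upwards [hK.isClosed.isOpen_compl.mem_nhds hx] with y hy using hWK y hy
    rw [this.fderiv_eq, fderiv_fun_const]
    rfl
  have hD {g : R2 → C3} (hg : ContDiff ℝ ∞ g) (u : R2) : ContDiff ℝ ∞ (fun x => fderiv ℝ g x u) :=
    (hg.fderiv_right (by simp)).clm_apply contDiff_const
  -- The integrand vanishes off K, so the integral extends to the whole plane and integration by
  -- parts has no boundary term.
  rw [setIntegral_eq_integral_of_forall_compl_eq_zero fun x hx => by simp [hdW x hx]]
  have hint (i : Fin 2) : Integrable fun x : R2 =>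
      inner ℝ (fderiv ℝ f x (EuclideanSpace.single i 1))
        (fderiv ℝ W x (EuclideanSpace.single i 1)) := by
    refine ((hD hf _).continuous.inner (hD hW _).continuous).integrable_of_hasCompactSupport ?_
    exact HasCompactSupport.intro hK fun x hx => by simp [hdW x hx]
  have hint' (i : Fin 2) : Integrable fun x : R2 =>
      inner ℝ (fderiv ℝ (fun x => fderiv ℝ f x (EuclideanSpace.single i 1)) x
        (EuclideanSpace.single i 1)) (W x) := by
    refine ((hD (hD hf _) _).continuous.inner hW.continuous).integrable_of_hasCompactSupport ?_
    exact HasCompactSupport.intro hK fun x hx => by simp [hWK x hx]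
  rw [integral_finsetSum _ fun i _ => hint i]
  have hparts (i : Fin 2) : ∫ x : R2, inner ℝ (fderiv ℝ f x (EuclideanSpace.single i 1))
        (fderiv ℝ W x (EuclideanSpace.single i 1))
      = -∫ x : R2, inner ℝ (fderiv ℝ (fun x => fderiv ℝ f x (EuclideanSpace.single i 1)) x
        (EuclideanSpace.single i 1)) (W x) := by
    refine integral_bilinear_fderiv_right_eq_neg_left_of_integrable (B := innerSL ℝ)
      (f := fun x => fderiv ℝ f x (EuclideanSpace.single i 1)) (g := W)
      (hint' i) (hint i) ?_ (fun x _ => ?_) (fun x _ => ?_)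
    · refine ((hD hf _).continuous.inner hW.continuous).integrable_of_hasCompactSupport ?_
      exact HasCompactSupport.intro hK fun x hx => by simp [hWK x hx]
    · exact (hD hf _).differentiable (by simp) x
    · exact hW.differentiable (by simp) x
  rw [Finset.sum_congr rfl fun i _ => hparts i, Finset.sum_neg_distrib,
    ← integral_finsetSum _ fun i _ => hint' i]
  simp only [← sum_inner, hfW, integral_zero, neg_zero]

variable {E F : Type*} [NormedAddCommGroup E] [NormedSpace ℝ E] [NormedAddCommGroup F]
  [NormedSpace ℝ F]

theorem fderiv_slice {G : ℝ × E → F} {ε : ℝ} {x : E} (hG : DifferentiableAt ℝ G (ε, x)) (u : E) :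
    fderiv ℝ (fun x => G (ε, x)) x u = fderiv ℝ G (ε, x) (0, u) := by
  have : HasFDerivAt (fun x => G (ε, x)) _ x := hG.hasFDerivAt.comp x (hasFDerivAt_prodMk_right ε x)
  rw [this.fderiv]
  rfl

/-- The `ε`-derivative of the spatial derivative is the spatial derivative of the variation
field. -/
theorem hasDerivAt_fderiv_slice {G : ℝ × E → F} {ε : ℝ} {x : E} (hG : ContDiffAt ℝ ∞ G (ε, x))
    (u : E) :
    HasDerivAt (fun ε => fderiv ℝ G (ε, x) (0, u))
      (fderiv ℝ (fun x => fderiv ℝ G (ε, x) (1, 0)) x u) ε := by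
  have hd : DifferentiableAt ℝ (fderiv ℝ G) (ε, x) :=
    (hG.fderiv_right (m := ∞) (by simp)).differentiableAt (by simp)
  have h1 : HasDerivAt (fun ε => fderiv ℝ G (ε, x)) (fderiv ℝ (fderiv ℝ G) (ε, x) (1, 0)) ε :=
    hd.hasFDerivAt.comp_hasDerivAt ε ((hasDerivAt_id ε).prodMk (hasDerivAt_const ε x))
  have h2 := h1.clm_apply (hasDerivAt_const ε ((0 : ℝ), u))
  refine h2.congr_deriv ?_
  have h3 := (hd.clm_apply (differentiableAt_const ((1 : ℝ), (0 : E))))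
  rw [fderiv_slice h3 u, fderiv_clm_apply hd (differentiableAt_const _)]
  have hs : IsSymmSndFDerivAt ℝ G (ε, x) := hG.isSymmSndFDerivAt <| by
    rw [minSmoothness_of_isRCLikeNormedField]
    exact WithTop.coe_le_coe.2 (le_top (a := (2 : ℕ∞)))
  simp [hs.eq (1, 0) (0, u)]

end Variation

/-! ### Criteria for harmonicity in the sphere and in the projective plane. -/

section Harmonic

open MeasureTheory Set

/-- First variation of the energy: an energy density whose variation is the one of the Dirichlet
energy has a critical point at a map with Laplacian parallel to itself, if the variation field is
orthogonal to the map. -/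
theorem hasDerivAt_energy_eq_zero {f : R2 → C3} {G : ℝ × R2 → C3} {e : ℝ × R2 → ℝ} {K : Set R2}
    {δ : ℝ} (hδ : 0 < δ) (hK : IsCompact K) (hf : ContDiff ℝ ∞ f)
    (hlap : ∀ x, ∃ m : ℝ, ∑ i : Fin 2, fderiv ℝ
      (fun x => fderiv ℝ f x (EuclideanSpace.single i 1)) x (EuclideanSpace.single i 1) = m • f x)
    (hG : ∀ ε ∈ Metric.ball (0 : ℝ) δ, ∀ x, ContDiffAt ℝ ∞ G (ε, x))
    (hGK : ∀ ε ∈ Metric.ball (0 : ℝ) δ, ∀ x ∉ K, G (ε, x) = f x)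
    (horth : ∀ x, inner ℝ (f x) (fderiv ℝ G (0, x) (1, 0)) = 0)
    (he : ∀ ε ∈ Metric.ball (0 : ℝ) δ, ∀ x, ContDiffAt ℝ ∞ e (ε, x))
    (hd : ∀ x, HasDerivAt (fun ε => e (ε, x)) (2 * ∑ i : Fin 2,
      inner ℝ (fderiv ℝ f x (EuclideanSpace.single i 1))
        (fderiv ℝ (fun x => fderiv ℝ G (0, x) (1, 0)) x (EuclideanSpace.single i 1))) 0) :
    HasDerivAt (fun ε => ∫ x in K, e (ε, x)) 0 0 := by
  have h0 : (0 : ℝ) ∈ Metric.ball (0 : ℝ) δ := Metric.mem_ball_self hδ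
  have hmain := hasDerivAt_setIntegral_of_contDiffOn (μ := volume) hδ hK (e := e)
    fun p hp => ((he p.1 hp.1 p.2).of_le (by simp)).contDiffWithinAt
  refine hmain.congr_deriv ?_
  have hde (x : R2) : fderiv ℝ e (0, x) (1, 0) = 2 * ∑ i : Fin 2,
      inner ℝ (fderiv ℝ f x (EuclideanSpace.single i 1))
        (fderiv ℝ (fun x => fderiv ℝ G (0, x) (1, 0)) x (EuclideanSpace.single i 1)) := by
    have h1 : HasFDerivAt e (fderiv ℝ e (0, x)) (0, x) :=
      ((he 0 h0 x).differentiableAt (by simp)).hasFDerivAt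
    exact (h1.comp_hasDerivAt 0 ((hasDerivAt_id (0 : ℝ)).prodMk (hasDerivAt_const 0 x))).unique
      (hd x)
  have hW : ContDiff ℝ ∞ fun x => fderiv ℝ G (0, x) (1, 0) := by
    rw [contDiff_iff_contDiffAt]
    intro x
    have h1 : ContDiffAt ℝ ∞ (fderiv ℝ G) (0, x) := (hG 0 h0 x).fderiv_right (by simp)
    exact (h1.comp x (contDiff_prodMk_right (0 : ℝ)).contDiffAt).clm_apply contDiffAt_const
  have hWK : ∀ x ∉ K, fderiv ℝ G (0, x) (1, 0) = 0 := by
    intro x hx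
    have h1 : HasFDerivAt G (fderiv ℝ G (0, x)) (0, x) :=
      ((hG 0 h0 x).differentiableAt (by simp)).hasFDerivAt
    have h2 := h1.comp_hasDerivAt 0 ((hasDerivAt_id (0 : ℝ)).prodMk (hasDerivAt_const 0 x))
    refine h2.unique ((hasDerivAt_const (0 : ℝ) (f x)).congr_of_eventuallyEq ?_)
    filter_upwards [Metric.ball_mem_nhds (0 : ℝ) hδ] with ε hε using hGK ε hε x hx
  simp only [hde, integral_const_mul]
  rw [setIntegral_fderiv_inner_fderiv_eq_zero hK hf hW hWK, mul_zero]
  intro x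
  obtain ⟨m, hm⟩ := hlap x
  rw [hm, real_inner_smul_left, horth, mul_zero]

theorem isHarmonicS5_of_laplacian {φ : R2 → S5} (hφ : SmoothS5 φ)
    (hlap : ∀ x, ∃ m : ℝ, ∑ i : Fin 2, fderiv ℝ
      (fun x => fderiv ℝ (fun y => (φ y : C3)) x (EuclideanSpace.single i 1)) x
        (EuclideanSpace.single i 1) = m • (φ x : C3)) : IsHarmonicS5 φ := by
  refine ⟨hφ, fun g K hg hK hg0 hgK => ?_⟩
  have hd (p : ℝ × R2) : DifferentiableAt ℝ (fun p => (g p : C3)) p := hg.differentiable (by simp) p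
  have hf0 (u x : R2) : fderiv ℝ (fun p => (g p : C3)) (0, x) (0, u)
      = fderiv ℝ (fun y => (φ y : C3)) x u := by
    rw [← fderiv_slice (hd _)]
    simp only [hg0]
  have hP (u : R2) : ContDiff ℝ ∞ fun p => fderiv ℝ (fun p => (g p : C3)) p (0, u) :=
    (hg.fderiv_right (by simp)).clm_apply contDiff_const
  have hmain := hasDerivAt_energy_eq_zero (G := fun p => (g p : C3)) (δ := 1)
    (e := fun p => ∑ i : Fin 2,
      inner ℝ (fderiv ℝ (fun p => (g p : C3)) p (0, EuclideanSpace.single i 1))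
        (fderiv ℝ (fun p => (g p : C3)) p (0, EuclideanSpace.single i 1)))
    one_pos hK hφ hlap (fun ε _ x => hg.contDiffAt) (fun ε _ x hx => by simp only [hgK ε x hx])
    ?_ ?_ ?_
  · convert hmain using 1
    funext ε
    refine integral_congr_ae (Filter.Eventually.of_forall fun x => ?_)
    refine Finset.sum_congr rfl fun i _ => ?_
    rw [pullS5, euclG_eq_inner_real, fderiv_slice (hd _)]
  -- The derivative of |g|² = 1 at ε = 0.
  · intro x
    have h1 := (hd (0, x)).hasFDerivAt.comp_hasDerivAt (0 : ℝ)
      ((hasDerivAt_id (0 : ℝ)).prodMk (hasDerivAt_const 0 x))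
    have h2 := h1.norm_sq
    have h3 : HasDerivAt (fun _ : ℝ => (1 : ℝ)) _ 0 :=
      h2.congr_of_eventuallyEq (Filter.Eventually.of_forall fun ε => by simp)
    have h4 := h3.unique (hasDerivAt_const _ _)
    simpa [hg0] using h4
  · intro ε _ x
    exact (ContDiff.sum fun i _ => (hP _).inner ℝ (hP _)).contDiffAt
  · intro x
    have h1 (i : Fin 2) := hasDerivAt_fderiv_slice (hg.contDiffAt (x := (0, x)))
      (EuclideanSpace.single i (1 : ℝ))
    refine (HasDerivAt.fun_sum fun i _ => (h1 i).inner ℝ (h1 i)).congr_deriv ?_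
    rw [Finset.mul_sum]
    refine Finset.sum_congr rfl fun i _ => ?_
    rw [hf0, real_inner_comm, two_mul]

/-- Writing |p|⁴ as (Re ⟨p, p⟩)² leaves only inner products to differentiate. -/
theorem fubiniStudy_self (p ξ : C3) : fubiniStudy p ξ ξ =
    (inner ℂ ξ ξ * inner ℂ p p - inner ℂ ξ p * inner ℂ p ξ).re / (inner ℂ p p).re ^ 2 := by
  have : (inner ℂ p p).re = ‖p‖ ^ 2 := inner_self_eq_norm_sq (𝕜 := ℂ) p
  rw [this, fubiniStudy]
  ring

theorem contDiffAt_fubiniStudy {E : Type*} [NormedAddCommGroup E] [NormedSpace ℝ E]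
    {P Ξ : E → C3} {x : E} {n : ℕ∞ω} (hP : ContDiffAt ℝ n P x) (hΞ : ContDiffAt ℝ n Ξ x)
    (h0 : P x ≠ 0) : ContDiffAt ℝ n (fun x => fubiniStudy (P x) (Ξ x) (Ξ x)) x := by
  simp only [fubiniStudy_self]
  have hre {h : E → ℂ} (hh : ContDiffAt ℝ n h x) : ContDiffAt ℝ n (fun x => (h x).re) x :=
    Complex.reCLM.contDiff.contDiffAt.comp x hh
  refine (hre (((hΞ.inner ℂ hΞ).mul (hP.inner ℂ hP)).sub ((hΞ.inner ℂ hP).mul (hP.inner ℂ hΞ)))).div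
    ((hre (hP.inner ℂ hP)).pow 2) ?_
  have : (inner ℂ (P x) (P x)).re = ‖P x‖ ^ 2 := inner_self_eq_norm_sq (𝕜 := ℂ) (P x)
  rw [this]
  exact pow_ne_zero _ (pow_ne_zero _ (norm_ne_zero_iff.2 h0))

/-- First variation of the Fubini-Study square norm at a horizontal vector, in the direction of
horizontally varying unit homogeneous coordinates. -/
theorem hasDerivAt_fubiniStudy {P Ξ : ℝ → C3} {P' Ξ' : C3} {ε : ℝ} (hP : HasDerivAt P P' ε)
    (hΞ : HasDerivAt Ξ Ξ' ε) (h1 : inner ℂ (P ε) (P ε) = 1) (h2 : inner ℂ (P ε) P' = 0)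
    (h3 : inner ℂ (P ε) (Ξ ε) = 0) :
    HasDerivAt (fun ε => fubiniStudy (P ε) (Ξ ε) (Ξ ε)) (2 * inner ℝ (Ξ ε) Ξ') ε := by
  simp only [fubiniStudy_self]
  have hre {h : ℝ → ℂ} {h' : ℂ} (hh : HasDerivAt h h' ε) :
      HasDerivAt (fun x => (h x).re) h'.re ε :=
    Complex.reCLM.hasFDerivAt.comp_hasDerivAt ε hh
  have h2' : inner ℂ P' (P ε) = 0 := inner_eq_zero_symm.1 h2
  have h3' : inner ℂ (Ξ ε) (P ε) = 0 := inner_eq_zero_symm.1 h3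
  have hs : (inner ℂ Ξ' (Ξ ε)).re = (inner ℂ (Ξ ε) Ξ').re := by
    rw [← inner_conj_symm, Complex.conj_re]
  refine ((hre (((hΞ.inner ℂ hΞ).mul (hP.inner ℂ hP)).sub
    ((hΞ.inner ℂ hP).mul (hP.inner ℂ hΞ)))).div ((hre (hP.inner ℂ hP)).pow 2) ?_).congr_deriv ?_
  · simp [h1, -inner_self_eq_norm_sq_to_K]
  -- The denominator is stationary because ⟨P, P'⟩ = 0, and both factors of the subtracted product
  -- vanish, so only the derivative of |Ξ|² survives.
  · have : inner ℝ (Ξ ε) Ξ' = (inner ℂ (Ξ ε) Ξ').re := (euclG_eq_inner_real _ _).symm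
    simp [h1, h2, h2', h3, h3', hs, this, -inner_self_eq_norm_sq_to_K]
    ring

/-- The homogeneous coordinates of `g` with Hermitian product `1` with the reference vector. -/
noncomputable def normalizedLift {E : Type*} (r : E → C3) (g : E → CP2) (p : E) : C3 :=
  (inner ℂ (r p) (g p).rep)⁻¹ • (g p).rep

/-- Rescaling the representative cancels, so the arbitrary choice in `rep` is harmless and any
smooth local lift may replace it. -/
theorem normalizedLift_eq {E : Type*} {r : E → C3} {g : E → CP2} {p : E} {F : C3} {hF : F ≠ 0}
    (h : g p = Projectivization.mk ℂ F hF) :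
    normalizedLift r g p = (inner ℂ (r p) F)⁻¹ • F := by
  have e := (g p).mk_rep.trans h
  rw [Projectivization.mk_eq_mk_iff'] at e
  obtain ⟨a, ha⟩ := e
  have ha0 : a ≠ 0 := by
    rintro rfl
    exact (g p).rep_nonzero (by rw [← ha, zero_smul])
  rw [normalizedLift, ← ha, inner_smul_right, smul_smul, mul_inv, mul_comm a⁻¹, mul_assoc,
    inv_mul_cancel₀ ha0, mul_one]

theorem inner_normalizedLift {E : Type*} {r : E → C3} {g : E → CP2} {p : E}
    (h : inner ℂ (r p) (g p).rep ≠ 0) : inner ℂ (r p) (normalizedLift r g p) = 1 := by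
  rw [normalizedLift, inner_smul_right, inv_mul_cancel₀ h]

theorem mk_normalizedLift {E : Type*} {r : E → C3} {g : E → CP2} {p : E}
    (h : inner ℂ (r p) (g p).rep ≠ 0) :
    ∃ h0 : normalizedLift r g p ≠ 0, g p = Projectivization.mk ℂ (normalizedLift r g p) h0 := by
  have h0 : normalizedLift r g p ≠ 0 := smul_ne_zero (inv_ne_zero h) (g p).rep_nonzero
  refine ⟨h0, ?_⟩
  conv_lhs => rw [← (g p).mk_rep]
  rw [Projectivization.mk_eq_mk_iff']
  exact ⟨inner ℂ (r p) (g p).rep, by rw [normalizedLift, smul_inv_smul₀ h]⟩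

theorem isOpen_inner_rep_ne_zero_and_contDiffAt {E : Type*} [NormedAddCommGroup E]
    [NormedSpace ℝ E] {r : E → C3} {g : E → CP2} (hr : ContDiff ℝ ∞ r) (hg : SmoothCP2 g) :
    IsOpen {p | inner ℂ (r p) (g p).rep ≠ 0} ∧
      ∀ p, inner ℂ (r p) (g p).rep ≠ 0 → ContDiffAt ℝ ∞ (normalizedLift r g) p := by
  have key {p : E} {F : E → C3} (hF : IsLiftAt g F p) (hp : inner ℂ (r p) (g p).rep ≠ 0) :
      inner ℂ (r p) (F p) ≠ 0 := by
    obtain ⟨h0, h⟩ := hF.2.self_of_nhds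
    have e := h.symm.trans (g p).mk_rep.symm
    rw [Projectivization.mk_eq_mk_iff'] at e
    obtain ⟨a, ha⟩ := e
    rw [← ha, inner_smul_right]
    refine mul_ne_zero ?_ hp
    rintro rfl
    exact h0 (by rw [← ha, zero_smul])
  constructor
  · rw [isOpen_iff_eventually]
    intro p hp
    obtain ⟨F, hF⟩ := hg p
    have hc : ContinuousAt (fun q => inner ℂ (r q) (F q)) p :=
      hr.continuous.continuousAt.inner hF.1.continuousAt
    filter_upwards [hF.2, hc.eventually_ne (key hF hp)] with q hq hq'
    obtain ⟨h0, h⟩ := hq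
    intro h1
    have e := (g q).mk_rep.trans h
    rw [Projectivization.mk_eq_mk_iff'] at e
    obtain ⟨a, ha⟩ := e
    rw [← ha, inner_smul_right, mul_eq_zero] at h1
    rcases h1 with rfl | h1
    · exact (g q).rep_nonzero (by rw [← ha, zero_smul])
    · exact hq' h1
  · intro p hp
    obtain ⟨F, hF⟩ := hg p
    have h1 : ContDiffAt ℝ ∞ (fun q => inner ℂ (r q) (F q)) p := hr.contDiffAt.inner ℂ hF.1
    refine ((h1.inv (key hF hp)).smul hF.1).congr_of_eventuallyEq ?_
    filter_upwards [hF.2] with q hq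
    obtain ⟨h0, h⟩ := hq
    exact normalizedLift_eq h

theorem isLiftAt_hopf {E : Type*} [NormedAddCommGroup E] [NormedSpace ℝ E] {φ : E → S5}
    (hφ : SmoothS5 φ) (x : E) : IsLiftAt (fun x => hopf (φ x)) (fun x => (φ x : C3)) x :=
  ⟨hφ.contDiffAt, Filter.Eventually.of_forall fun y => ⟨ne_zero_of_mem_unit_sphere (φ y), rfl⟩⟩

theorem isHarmonicCP2_of_laplacian {φ : R2 → S5} (hφ : SmoothS5 φ)
    (hhor : ∀ x u, inner ℂ (φ x : C3) (fderiv ℝ (fun y => (φ y : C3)) x u) = 0)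
    (hlap : ∀ x, ∃ m : ℝ, ∑ i : Fin 2, fderiv ℝ
      (fun x => fderiv ℝ (fun y => (φ y : C3)) x (EuclideanSpace.single i 1)) x
        (EuclideanSpace.single i 1) = m • (φ x : C3)) : IsHarmonicCP2 (fun x => hopf (φ x)) := by
  refine ⟨fun x => ⟨_, isLiftAt_hopf hφ x⟩, fun g K hg hK hg0 hgK => ?_⟩
  have hφ1 (x) : inner ℂ (φ x : C3) (φ x : C3) = 1 := by
    rw [inner_self_eq_norm_sq_to_K]
    simp
  have hr : ContDiff ℝ ∞ fun p : ℝ × R2 => (φ p.2 : C3) := hφ.comp contDiff_snd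
  obtain ⟨hopen, hsm⟩ := isOpen_inner_rep_ne_zero_and_contDiffAt hr hg
  set G : ℝ × R2 → C3 := normalizedLift (fun p => (φ p.2 : C3)) g with hGdef
  have hGφ (p : ℝ × R2) (hp : g p = hopf (φ p.2)) : G p = φ p.2 := by
    rw [hGdef, normalizedLift_eq hp]
    simp
  -- If the product were zero, the convention 0⁻¹ = 0 would give G p = 0, whereas G p is a unit
  -- vector.
  have hne (p : ℝ × R2) (hp : g p = hopf (φ p.2)) :
      inner ℂ (φ p.2 : C3) (g p).rep ≠ 0 := by
    intro h
    have h1 := hGφ p hp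
    rw [hGdef, normalizedLift, h, inv_zero, zero_smul] at h1
    exact ne_zero_of_mem_unit_sphere (φ p.2) h1.symm
  -- Over K the tube lemma gives a uniform δ; off K the map does not move.
  obtain ⟨δ, hδ, hball⟩ : ∃ δ > 0, ∀ ε ∈ Metric.ball (0 : ℝ) δ, ∀ x : R2,
      inner ℂ (φ x : C3) (g (ε, x)).rep ≠ 0 := by
    obtain ⟨U, V, hU, -, h0U, hKV, hUV⟩ := generalized_tube_lemma (isCompact_singleton (x := (0 : ℝ)))
      hK hopen (by
        rintro ⟨ε, x⟩ ⟨rfl, -⟩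
        exact hne _ (hg0 x))
    obtain ⟨δ, hδ, hs⟩ := Metric.isOpen_iff.1 hU 0 (h0U rfl)
    refine ⟨δ, hδ, fun ε hε x => ?_⟩
    by_cases hx : x ∈ K
    · exact hUV (mk_mem_prod (hs hε) (hKV hx))
    · exact hne (ε, x) (hgK ε x hx)
  have h0 : (0 : ℝ) ∈ Metric.ball (0 : ℝ) δ := Metric.mem_ball_self hδ
  have hG : ∀ ε ∈ Metric.ball (0 : ℝ) δ, ∀ x, ContDiffAt ℝ ∞ G (ε, x) :=
    fun ε hε x => hsm _ (hball ε hε x)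
  have hP (u : R2) : ∀ ε ∈ Metric.ball (0 : ℝ) δ, ∀ x,
      ContDiffAt ℝ ∞ (fun p => fderiv ℝ G p (0, u)) (ε, x) := fun ε hε x =>
    ((hG ε hε x).fderiv_right (by simp)).clm_apply contDiffAt_const
  have hd (ε) (hε : ε ∈ Metric.ball (0 : ℝ) δ) (x) : DifferentiableAt ℝ G (ε, x) :=
    (hG ε hε x).differentiableAt (by simp)
  have hG0 (x : R2) : G (0, x) = φ x := hGφ (0, x) (hg0 x)
  have hf0 (u x : R2) : fderiv ℝ G (0, x) (0, u) = fderiv ℝ (fun y => (φ y : C3)) x u := by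
    rw [← fderiv_slice (hd 0 h0 x)]
    simp only [hG0]
  have hGt (x : R2) : HasDerivAt (fun ε => G (ε, x)) (fderiv ℝ G (0, x) (1, 0)) 0 := by
    have h1 : HasFDerivAt G (fderiv ℝ G (0, x)) (0, x) := (hd 0 h0 x).hasFDerivAt
    exact h1.comp_hasDerivAt (0 : ℝ) ((hasDerivAt_id (0 : ℝ)).prodMk (hasDerivAt_const 0 x))
  -- The derivative of the normalization ⟨φ, G⟩ = 1 in ε.
  have horth (x : R2) : inner ℂ (φ x : C3) (fderiv ℝ G (0, x) (1, 0)) = 0 := by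
    have h2 := (hasDerivAt_const (0 : ℝ) (φ x : C3)).inner ℂ (hGt x)
    have h3 : HasDerivAt (fun _ : ℝ => (1 : ℂ)) _ 0 := h2.congr_of_eventuallyEq <| by
      filter_upwards [Metric.ball_mem_nhds (0 : ℝ) hδ] with ε hε
      exact (inner_normalizedLift (r := fun p : ℝ × R2 => (φ p.2 : C3)) (hball ε hε x)).symm
    simpa using h3.unique (hasDerivAt_const _ _)
  have hmain := hasDerivAt_energy_eq_zero (G := G)
    (e := fun p => ∑ i : Fin 2, fubiniStudy (G p)
      (fderiv ℝ G p (0, EuclideanSpace.single i 1)) (fderiv ℝ G p (0, EuclideanSpace.single i 1)))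
    hδ hK hφ hlap hG (fun ε _ x hx => hGφ (ε, x) (hgK ε x hx)) ?_ ?_ ?_
  · refine hmain.congr_of_eventuallyEq ?_
    filter_upwards [Metric.ball_mem_nhds (0 : ℝ) hδ] with ε hε
    refine integral_congr_ae (Filter.Eventually.of_forall fun x => ?_)
    refine Finset.sum_congr rfl fun i _ => ?_
    have hlift : IsLiftAt (fun x => g (ε, x)) (fun x => G (ε, x)) x :=
      ⟨(hG ε hε x).comp x (contDiff_prodMk_right ε).contDiffAt,
        Filter.Eventually.of_forall fun y => mk_normalizedLift (hball ε hε y)⟩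
    rw [pullCP2_eq hlift, fderiv_slice (hd ε hε x)]
  · intro x
    rw [← euclG_eq_inner_real, euclG, horth, Complex.zero_re]
  · intro ε hε x
    exact ContDiffAt.sum fun i _ => contDiffAt_fubiniStudy (hG ε hε x) (hP _ ε hε x)
      (mk_normalizedLift (hball ε hε x)).1
  · intro x
    have h1 (i : Fin 2) := hasDerivAt_fderiv_slice (hG 0 h0 x) (EuclideanSpace.single i (1 : ℝ))
    refine (HasDerivAt.fun_sum fun i _ => hasDerivAt_fubiniStudy (hGt x) (h1 i) ?_ ?_ ?_).congr_deriv ?_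
    · rw [hG0, hφ1]
    · rw [hG0, horth]
    · rw [hG0, hf0, hhor]
    · simp only [hf0, Finset.mul_sum]

end Harmonic

/-! ### The induced conformal harmonic maps. -/

theorem theorem5p4
    (θ : ℝ) (_hθ : θ ∈ Set.Ico 0 (2 * Real.pi))
    (β γ : Fin 3 → ℝ) (hβ : β = coeffBeta θ) (hγ : γ = coeffGamma θ)
    (y z : Fin 3 → ℝ → ℂ) (v w : ℝ → ℝ)
    (hy : ∀ j s, HasDerivAt (y j)
      ((β j : ℂ) * (starRingEnd ℂ) (y (j + 1) s * y (j + 2) s)) s)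
    (hz : ∀ j t, HasDerivAt (z j)
      ((γ j : ℂ) * (starRingEnd ℂ) (z (j + 1) t * z (j + 2) t)) t)
    (hv : ∀ j s, ‖y j s‖ ^ 2 = β j * v s + 1)
    (hw : ∀ j t, ‖z j t‖ ^ 2 = γ j * w t + 1)
    (a b c : ℝ)
    (ha : a = 1 / 6 * ∑ j, β j ^ 2)
    (hb : b = -(1 / 6) * ∑ j, β j ^ 3)
    (hc : c = 1 / 6 * ∑ j, β j ^ 2 * γ j)
    (Φ : ℝ → ℝ → ℝ → C3) (hΦ : Φ = mapPhi y z) :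
    -- the constants
    (a = 1 / 6 * ∑ j, γ j ^ 2 ∧ a = 1 / 6) ∧
    (b = 1 / 6 * ∑ j, β j * γ j ^ 2 ∧ b = -(1 / 2) * (β 0 * β 1 * β 2)) ∧
    (c = -(1 / 6) * ∑ j, γ j ^ 3 ∧ c = -(1 / 2) * (γ 0 * γ 1 * γ 2)) ∧
    -- the map and its partial derivatives
    ContDiff ℝ ∞ (fun p : ℝ × ℝ × ℝ => Φ p.1 p.2.1 p.2.2) ∧
    (∀ r s t : ℝ,
      ‖Φ r s t‖ ^ 2 = r ^ 2 ∧
      euclG (deriv (fun r' => Φ r' s t) r) (deriv (fun s' => Φ r s' t) s) = 0 ∧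
      euclG (deriv (fun r' => Φ r' s t) r) (deriv (fun t' => Φ r s t') t) = 0 ∧
      euclG (deriv (fun s' => Φ r s' t) s) (deriv (fun t' => Φ r s t') t) = 0 ∧
      ‖deriv (fun r' => Φ r' s t) r‖ ^ 2 = 1 ∧
      ‖deriv (fun s' => Φ r s' t) s‖ ^ 2 = 2 * r ^ 2 * (a + b * v s + c * w t) ∧
      ‖deriv (fun t' => Φ r s t') t‖ ^ 2 = 2 * r ^ 2 * (a + b * v s + c * w t)) ∧
    -- the induced maps into the sphere and the projective plane
    ∃ φ : R2 → S5, (∀ x, (φ x : C3) = Φ 1 (x 0) (x 1)) ∧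
      IsConformalWith (pullS5 φ) (fun x => 2 * (a + b * v (x 0) + c * w (x 1))) ∧
      IsHarmonicS5 φ ∧
      IsConformalWith (pullCP2 fun x => hopf (φ x))
        (fun x => 2 * (a + b * v (x 0) + c * w (x 1))) ∧
      IsHarmonicCP2 (fun x => hopf (φ x)) := by

  have h : CoeffRel β γ := by
    rw [hβ, hγ]
    exact coeffRel θ
  have hy' : IsTriple β y v := ⟨hy, hv⟩
  have hz' : IsTriple γ z w := ⟨hz, hw⟩
  subst hΦ
  rw [Fin.sum_univ_three] at ha hb hc
  have ha' : a = 1 / 6 := by linear_combination ha + 1 / 6 * h.sq_left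
  have hb' : b = -(1 / 2) * (β 0 * β 1 * β 2) := by linear_combination hb - 1 / 6 * h.cube_sum
  have hc' : c = -(1 / 2) * (γ 0 * γ 1 * γ 2) := by
    linear_combination hc + 1 / 6 * h.symm.mixed_sum
  have hlam (r s t : ℝ) : r ^ 2 * (1 / 3 - β 0 * β 1 * β 2 * v s - γ 0 * γ 1 * γ 2 * w t)
      = 2 * r ^ 2 * (a + b * v s + c * w t) := by
    rw [ha', hb', hc']
    ring
  have hr' (r s t : ℝ) : deriv (fun r' => mapPhi y z r' s t) r = mapPhi y z 1 s t := by
    rw [(hasDerivAt_mapPhi (fun j => hy'.hasDerivAt j s) (fun j => hz'.hasDerivAt j t)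
      (hasDerivAt_id' r) (hasDerivAt_const r s) (hasDerivAt_const r t)).deriv]
    simp
  have hm0 (y z : Fin 3 → ℝ → ℂ) (s t : ℝ) : mapPhi y z 0 s t = 0 := by
    ext j
    simp [mapPhi_apply]
  have hs' (r s t : ℝ) : deriv (fun s' => mapPhi y z r s' t) s
      = mapPhi (tripleVel β y) z r s t := by
    rw [(hasDerivAt_mapPhi (fun j => hy'.hasDerivAt j s) (fun j => hz'.hasDerivAt j t)
      (hasDerivAt_const s r) (hasDerivAt_id' s) (hasDerivAt_const s t)).deriv]
    simp [hm0]
  have ht' (r s t : ℝ) : deriv (fun t' => mapPhi y z r s t') t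
      = mapPhi y (tripleVel γ z) r s t := by
    rw [(hasDerivAt_mapPhi (fun j => hy'.hasDerivAt j s) (fun j => hz'.hasDerivAt j t)
      (hasDerivAt_const t r) (hasDerivAt_const t s) (hasDerivAt_id' t)).deriv]
    simp [hm0]
  refine ⟨⟨?_, ha'⟩, ⟨?_, hb'⟩, ⟨?_, hc'⟩, ?_, fun r s t => ?_, ?_⟩
  · rw [Fin.sum_univ_three]
    linear_combination ha' - 1 / 6 * h.symm.sq_left
  · rw [Fin.sum_univ_three]
    linear_combination hb' - 1 / 6 * h.mixed_sum
  · rw [Fin.sum_univ_three]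
    linear_combination hc' + 1 / 6 * h.symm.cube_sum
  · exact contDiff_mapPhi hy'.contDiff hz'.contDiff contDiff_fst (contDiff_fst.comp contDiff_snd)
      (contDiff_snd.comp contDiff_snd)
  · rw [hr', hs', ht', euclG, euclG, euclG, inner_mapPhi_vel h hz', inner_mapPhi_vel_right h hy',
      inner_mapPhi_vel_vel h, ← hlam]
    refine ⟨norm_sq_eq_of_inner_self ?_, rfl, rfl, rfl, norm_sq_eq_of_inner_self ?_,
      norm_sq_eq_of_inner_self (inner_vel_self h hy' hz' r s t),
      norm_sq_eq_of_inner_self (inner_vel_right_self h hy' hz' r s t)⟩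
    · rw [inner_mapPhi_self h hy' hz']
      push_cast
      ring
    · rw [inner_mapPhi_self h hy' hz']
      simp
  -- The conformal factor is |∂Φ/∂s|² at r = 1.
  · have hlam0 (x : R2) : 0 ≤ 2 * (a + b * v (x 0) + c * w (x 1)) := by
      have := norm_sq_eq_of_inner_self (inner_vel_self h hy' hz' 1 (x 0) (x 1))
      rw [hlam, one_pow, mul_one] at this
      rw [← this]
      positivity
    have hinner (x u u' : R2) : inner ℂ (fderiv ℝ (planeMap y z) x u) (fderiv ℝ (planeMap y z) x u')
        = ((2 * (a + b * v (x 0) + c * w (x 1)) * inner ℝ u u' : ℝ) : ℂ) := by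
      have := hlam 1 (x 0) (x 1)
      rw [one_pow, one_mul, mul_one] at this
      rw [inner_fderiv_planeMap h hy' hz', this]
    let φ : R2 → S5 := fun x => ⟨planeMap y z x, by
      rw [mem_sphere_zero_iff_norm, norm_planeMap h hy' hz']⟩
    have hφ : SmoothS5 φ := contDiff_planeMap hy' hz'
    refine ⟨φ, fun x => rfl, fun x => ⟨hlam0 x, fun u u' => ?_⟩,
      isHarmonicS5_of_laplacian hφ (laplacian_planeMap h hy' hz'),
      fun x => ⟨hlam0 x, fun u u' => ?_⟩,
      isHarmonicCP2_of_laplacian hφ (inner_planeMap_fderiv h hy' hz')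
        (laplacian_planeMap h hy' hz')⟩
    · exact congrArg Complex.re (hinner x u u')
    · rw [pullCP2_eq (isLiftAt_hopf hφ x)]
      change fubiniStudy (planeMap y z x) (fderiv ℝ (planeMap y z) x u)
        (fderiv ℝ (planeMap y z) x u') = _
      rw [fubiniStudy, hinner, inner_planeMap_fderiv h hy' hz', inner_self_eq_norm_sq_to_K,
        norm_planeMap h hy' hz']
      simp only [mul_zero, sub_zero, one_pow, div_one, RCLike.ofReal_one, mul_one,
        Complex.ofReal_re]
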